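/- For finite sets $s,t$ of natural numbers write $s\triangleleft t$ if there are $n_0<n_1<\dots<n_{k+\ell}$ such that $s=\{n_0,\dots,n_k\}$ and $t=\{n_1,\dots,n_{k+\ell}\}$. A barrier on $\omega$ is a family $\mathcal B$ of non-empty finite subsets of $\omega$, pairwise incomparable under inclusion, such that every infinite $A\subseteq\omega$ has an initial segment belonging to $\mathcal B$. A poset $P$ is better quasi-ordered (bqo) if for every barrier $\mathcal B$ on $\omega$ and every function $f:\mathcal B\to P$ there are $s,t\in\mathcal B$ with $s\triangleleft t$ and $f(s)\le f(t)$. A poset is well quasi-ordered (wqo) if it is well founded and all its antichains are finite. A sublattice of a Boolean algebra is a subset closed under the binary meet and join, and subsets of a Boolean algebra carry the induced order. (1) Let $B$ be a Boolean algebra and let $Q\subseteq B$. If $Q$ is bqo, then the sublattice of $B$ generated by $Q$ is bqo. (2) The analogous statement for wqo fails. Let $R$ be the Rado poset, that is, the set $\{(i,j)\in\omega\times\omega : i<j\}$ ordered by $(i,j)\le(k,l)$ iff ($i=k$ and $j\le l$) or $j<k$. Let $F(R)$ be the poset algebra of $R$, that is, the Boolean algebra generated by the image of an order-preserving injection $x:R\to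 F(R)$ such that every order-preserving map from $R$ into a Boolean algebra $C$ extends along $x$ to a Boolean homomorphism $F(R)\to C$. Then $R$ is wqo and its image $x[R]\subseteq F(R)$ is wqo, but the sublattice $L(R)$ of $F(R)$ generated by $x[R]$ is not wqo. -/

import Mathlib

/-! ### Better quasi-orderings -/

/-- `s` is an initial segment of the set `A` of natural numbers. -/
def IsInitialSegment (s : Finset ℕ) (A : Set ℕ) : Prop :=
  (∀ n ∈ s, n ∈ A) ∧ ∀ a ∈ A, ∀ n ∈ s, a ≤ n → a ∈ s

/-- `𝓑` is a barrier on the infinite set `S` of natural numbers: a family of non-empty finite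
subsets of `S`, pairwise incomparable under inclusion, such that every infinite subset of `S` has an
initial segment in `𝓑`. -/
structure IsBarrier (𝓑 : Set (Finset ℕ)) (S : Set ℕ) : Prop where
  infinite : S.Infinite
  nonempty : ∀ s ∈ 𝓑, s.Nonempty
  subset : ∀ s ∈ 𝓑, ∀ n ∈ s, n ∈ S
  incomparable : ∀ s ∈ 𝓑, ∀ t ∈ 𝓑, s ⊆ t → s = t
  exists_initialSegment : ∀ A : Set ℕ, A ⊆ S → A.Infinite → ∃ s ∈ 𝓑, IsInitialSegment s A

/-- `s ◁ t`: for some `n₀ < n₁ < ⋯ < n_{k+ℓ}` we have `s = {n₀, …, n_k}` and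
`t = {n₁, …, n_{k+ℓ}}`. Here `n` is `n₀ = min s`. -/
def Precedes (s t : Finset ℕ) : Prop :=
  ∃ n ∈ s, (∀ m ∈ s, n ≤ m) ∧ (∀ m ∈ t, n < m) ∧ IsInitialSegment (s.erase n) {m | m ∈ t}

/-- `P` is better quasi-ordered (bqo): for every barrier `𝓑` on `ω` and every map `f : 𝓑 → P`
there are `s ◁ t` in `𝓑` with `f s ≤ f t`. -/
def BetterQuasiOrdered (P : Type*) [LE P] : Prop :=
  ∀ (𝓑 : Set (Finset ℕ)), IsBarrier 𝓑 Set.univ → ∀ f : 𝓑 → P,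
    ∃ s t : 𝓑, Precedes s.1 t.1 ∧ f s ≤ f t

/-! ### Poset algebras -/

/-- The map `x : P → F` makes the Boolean algebra `F` a poset algebra of `P`: it is an
order-preserving injection, its image generates `F`, and every order-preserving map from `P` to a
Boolean algebra `B` extends to a homomorphism of Boolean algebras `F → B`. -/
structure IsPosetAlgebra.{u, v, w} {P : Type u} [PartialOrder P] {F : Type v} [BooleanAlgebra F]
    (x : P → F) : Prop where
  monotone : Monotone x
  injective : Function.Injective x
  generates : BooleanSubalgebra.closure (Set.range x) = ⊤
  lift : ∀ (B : Type w) [BooleanAlgebra B] (f : P → B), Monotone f →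
    ∃ h : BoundedLatticeHom F B, ∀ p, h (x p) = f p

/-- The poset algebra `F(P)`, realized as the Boolean algebra of sets of final segments of `P`
generated by the sets `{U | p ∈ U}` with `p ∈ P`. -/
abbrev PosetAlgebra (P : Type*) [PartialOrder P] : Type _ :=
  BooleanSubalgebra.closure (Set.range fun p : P => {U : UpperSet P | p ∈ U})

/-- The generator `x_p = {U | p ∈ U}` of the poset algebra `F(P)`. -/
def PosetAlgebra.gen {P : Type*} [PartialOrder P] (p : P) : PosetAlgebra P :=
  ⟨{U : UpperSet P | p ∈ U}, BooleanSubalgebra.subset_closure ⟨p, rfl⟩⟩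

/-- A Boolean homomorphism `F(P) → B` extending a given order-preserving map `P → B`. -/
theorem PosetAlgebra.exists_lift.{u, w} {P : Type u} [PartialOrder P] (B : Type w)
    [BooleanAlgebra B] (f : P → B) (hf : Monotone f) :
    ∃ h : BoundedLatticeHom (PosetAlgebra P) B, ∀ p, h (PosetAlgebra.gen p) = f p := by
  classical
  let V : Order.Ideal B → UpperSet P := fun I =>
    ⟨{p | f p ∉ I}, fun p q hpq hp hq => hp (I.lower (hf hpq) hq)⟩
  -- prime ideals separate points
  have sep : ∀ a b : B, (∀ I : Order.Ideal B, I.IsPrime → (a ∉ I ↔ b ∉ I)) → a ≤ b := by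
    intro a b h
    by_contra hab
    obtain ⟨J, hJ, hIJ, hd⟩ := DistribLattice.prime_ideal_of_disjoint_filter_ideal
      (F := Order.PFilter.principal a) (I := Order.Ideal.principal b) (by
        rw [Set.disjoint_left]
        intro c hc hc'
        exact hab ((Order.PFilter.mem_principal.1 hc).trans (Order.Ideal.mem_principal.1 hc')))
    have hb : b ∈ J := hIJ (Order.Ideal.mem_principal.2 le_rfl)
    have ha : a ∉ J := Set.disjoint_left.1 hd (Order.PFilter.mem_principal.2 le_rfl)
    exact (h J hJ).1 ha hb
  have uniq : ∀ a b : B, (∀ I : Order.Ideal B, I.IsPrime → (a ∉ I ↔ b ∉ I)) → a = b :=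
    fun a b h => le_antisymm (sep a b h) (sep b a fun I hI => (h I hI).symm)
  have hsup : ∀ (I : Order.Ideal B) (a b : B), a ⊔ b ∉ I ↔ (a ∉ I ∨ b ∉ I) := by
    intro I a b
    rw [Order.Ideal.sup_mem_iff]
    tauto
  have hinf : ∀ (I : Order.Ideal B), I.IsPrime → ∀ a b : B, a ⊓ b ∉ I ↔ (a ∉ I ∧ b ∉ I) := by
    intro I hI a b
    constructor
    · intro h
      exact ⟨fun ha => h (I.lower inf_le_left ha), fun hb => h (I.lower inf_le_right hb)⟩
    · rintro ⟨ha, hb⟩ h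
      exact (hI.mem_or_mem h).elim ha hb
  have htop : ∀ (I : Order.Ideal B), I.IsPrime → (⊤ : B) ∉ I := fun I hI =>
    hI.toIsProper.top_notMem
  have ex : ∀ S : PosetAlgebra P, ∃ b : B, ∀ I : Order.Ideal B, I.IsPrime →
      (V I ∈ S.1 ↔ b ∉ I) := by
    rintro ⟨S, hS⟩
    induction hS using BooleanSubalgebra.closure_bot_sup_induction with
    | mem S hS =>
      obtain ⟨p, rfl⟩ := hS
      exact ⟨f p, fun I _ => Iff.rfl⟩
    | bot => exact ⟨⊥, fun I _ => by simp⟩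
    | sup S hS T hT ihS ihT =>
      obtain ⟨a, ha⟩ := ihS
      obtain ⟨b, hb⟩ := ihT
      refine ⟨a ⊔ b, fun I hI => ?_⟩
      rw [hsup, ← ha I hI, ← hb I hI]
      rfl
    | compl S hS ihS =>
      obtain ⟨a, ha⟩ := ihS
      refine ⟨aᶜ, fun I hI => ?_⟩
      have h1 : V I ∈ Sᶜ ↔ ¬ V I ∈ S := Iff.rfl
      rw [h1, ha I hI, not_not]
      constructor
      · intro h h'
        exact htop I hI (by simpa using Order.Ideal.sup_mem h h')
      · intro h
        exact (hI.mem_or_compl_mem (x := a)).resolve_right h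
  choose g hg using ex
  refine ⟨{ toFun := g, map_sup' := ?_, map_inf' := ?_, map_top' := ?_, map_bot' := ?_ }, ?_⟩
  · intro S T
    refine uniq _ _ fun I hI => ?_
    rw [hsup, ← hg _ I hI, ← hg _ I hI, ← hg _ I hI]
    rfl
  · intro S T
    refine uniq _ _ fun I hI => ?_
    rw [hinf I hI, ← hg _ I hI, ← hg _ I hI, ← hg _ I hI]
    rfl
  · refine uniq _ _ fun I hI => ?_
    rw [← hg _ I hI]
    exact ⟨fun _ => htop I hI, fun _ => trivial⟩
  · refine uniq _ _ fun I hI => ?_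
    rw [← hg _ I hI]
    exact ⟨fun h => h.elim, fun h => (h I.bot_mem).elim⟩
  · intro p
    refine uniq _ _ fun I hI => ?_
    exact (hg (PosetAlgebra.gen p) I hI).symm

/-- `F(P)` has the universal property that characterizes the poset algebra of `P`. -/
theorem PosetAlgebra.isPosetAlgebra.{u, w} (P : Type u) [PartialOrder P] :
    IsPosetAlgebra.{u, u, w} (PosetAlgebra.gen : P → PosetAlgebra P) where
  monotone p q hpq U hU := U.upper hpq hU
  injective p q h := by
    have key : ∀ p q : P, (PosetAlgebra.gen p : PosetAlgebra P) = PosetAlgebra.gen q → q ≥ p := by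
      intro p q h
      have h1 : {U : UpperSet P | p ∈ U} = {U : UpperSet P | q ∈ U} := congrArg Subtype.val h
      have h2 : UpperSet.Ici p ∈ {U : UpperSet P | q ∈ U} := h1 ▸ UpperSet.mem_Ici_iff.2 le_rfl
      exact UpperSet.mem_Ici_iff.1 h2
    exact le_antisymm (key p q h) (key q p h.symm)
  generates := by
    rw [eq_top_iff]
    rintro ⟨S, hS⟩ -
    induction hS using BooleanSubalgebra.closure_bot_sup_induction with
    | mem S hS =>
      obtain ⟨p, rfl⟩ := hS
      exact BooleanSubalgebra.subset_closure ⟨p, rfl⟩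
    | bot => exact BooleanSubalgebra.bot_mem
    | sup S hS T hT ihS ihT => exact BooleanSubalgebra.sup_mem ihS ihT
    | compl S hS ihS => exact BooleanSubalgebra.compl_mem ihS
  lift B _ f hf := PosetAlgebra.exists_lift B f hf

/-! ### The Rado poset -/

/-- The underlying set of the Rado poset: the pairs `(fst, snd)` of natural numbers with
`fst < snd`. -/
@[ext]
structure RadoPoset : Type where
  fst : ℕ
  snd : ℕ
  lt : fst < snd

/-- The order of the Rado poset: `(i, j) ≤ (k, l)` iff `i = k` and `j ≤ l`, or `j < k`. -/
instance : PartialOrder RadoPoset where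
  le p q := (p.fst = q.fst ∧ p.snd ≤ q.snd) ∨ p.snd < q.fst
  le_refl p := Or.inl ⟨rfl, le_rfl⟩
  le_trans p q r hpq hqr := by
    have := q.lt
    omega
  le_antisymm p q hpq hqp := by
    have hp := p.lt
    have hq := q.lt
    have : p.fst = q.fst ∧ p.snd = q.snd := by omega
    exact RadoPoset.ext this.1 this.2

/-! ### Squares of barriers -/

/-! Let `f` be a bad map from a barrier to finite meets from `Q`. For `s ◁ t` some meetand `g s t`
of `f t` is not above `f s`. The unions `s ∪ t` form a barrier again (`IsBarrier.square`), so if `Q`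
is bqo there are `r ◁ s ◁ t` with `g r s ≤ g s t`; then `f s ≤ g r s ≤ g s t`, a contradiction.
Joins are dual, and by distributivity joins of meets exhaust the generated sublattice. For wqo, the
meets of the finite columns of the Rado poset form a bad sequence: in `F(P)` a finite meet of
generators is below `x_q` only if some index is below `q`. -/

theorem IsInitialSegment.subset_or_subset {s t : Finset ℕ} {A : Set ℕ}
    (hs : IsInitialSegment s A) (ht : IsInitialSegment t A) : s ⊆ t ∨ t ⊆ s := by
  by_contra! h
  obtain ⟨x, hxs, hxt⟩ := Finset.not_subset.1 h.1
  obtain ⟨y, hyt, hys⟩ := Finset.not_subset.1 h.2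
  rcases le_total x y with hxy | hyx
  · exact hxt (ht.2 x (hs.1 x hxs) y hyt hxy)
  · exact hys (hs.2 y (ht.1 y hyt) x hxs hyx)

theorem IsBarrier.eq_of_isInitialSegment {𝓑 : Set (Finset ℕ)} {S A : Set ℕ}
    (h𝓑 : IsBarrier 𝓑 S) {s t : Finset ℕ} (hs𝓑 : s ∈ 𝓑) (ht𝓑 : t ∈ 𝓑)
    (hs : IsInitialSegment s A) (ht : IsInitialSegment t A) : s = t :=
  (hs.subset_or_subset ht).elim (h𝓑.incomparable s hs𝓑 t ht𝓑)
    fun h => (h𝓑.incomparable t ht𝓑 s hs𝓑 h).symm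

theorem Precedes.isInitialSegment_union {s t : Finset ℕ} (h : Precedes s t) :
    IsInitialSegment s {m | m ∈ s ∪ t} := by
  obtain ⟨n, -, -, hlt, hseg⟩ := h
  refine ⟨fun m hm => Finset.mem_union_left t hm, fun a ha m hm ham => ?_⟩
  rcases Finset.mem_union.1 ha with has | hat
  · exact has
  · have hnm : m ≠ n := ((hlt a hat).trans_le ham).ne'
    exact Finset.mem_of_mem_erase (hseg.2 a hat m (Finset.mem_erase.2 ⟨hnm, hm⟩) ham)

theorem Precedes.exists_union_eq_insert {s t : Finset ℕ} (h : Precedes s t) :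
    ∃ n, s ∪ t = insert n t ∧ ∀ m ∈ t, n < m := by
  obtain ⟨n, hn, -, hlt, hseg⟩ := h
  refine ⟨n, ?_, hlt⟩
  ext m
  simp only [Finset.mem_union, Finset.mem_insert]
  constructor
  · rintro (hm | hm)
    · by_cases hmn : m = n
      · exact Or.inl hmn
      · exact Or.inr (hseg.1 m (Finset.mem_erase.2 ⟨hmn, hm⟩))
    · exact Or.inr hm
  · rintro (rfl | hm)
    · exact Or.inl hn
    · exact Or.inr hm

/-- The square of a family `𝓑` of finite sets: the family of all `s ∪ t` with `s ◁ t` in `𝓑`. -/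
def barrierSquare (𝓑 : Set (Finset ℕ)) : Set (Finset ℕ) :=
  {u | ∃ s ∈ 𝓑, ∃ t ∈ 𝓑, Precedes s t ∧ u = s ∪ t}

/-- Each member is some `t` in `𝓑` with one smaller point added. An inclusion between two members
therefore restricts to their `t`-parts, which must coincide. -/
theorem IsBarrier.square {𝓑 : Set (Finset ℕ)} {S : Set ℕ} (h𝓑 : IsBarrier 𝓑 S) :
    IsBarrier (barrierSquare 𝓑) S where
  infinite := h𝓑.infinite
  nonempty := by
    rintro _ ⟨s, hs, t, -, -, rfl⟩
    exact (h𝓑.nonempty s hs).mono Finset.subset_union_left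
  subset := by
    rintro _ ⟨s, hs, t, ht, -, rfl⟩ n hn
    exact (Finset.mem_union.1 hn).elim (h𝓑.subset s hs n) (h𝓑.subset t ht n)
  incomparable := by
    rintro _ ⟨s, hs, t, ht, hst, rfl⟩ _ ⟨s', hs', t', ht', hst', rfl⟩ hsub
    obtain ⟨n, hn, hlt⟩ := hst.exists_union_eq_insert
    obtain ⟨m, hm, hlt'⟩ := hst'.exists_union_eq_insert
    rw [hn, hm] at hsub ⊢
    have hmn : m ≤ n := by
      rcases Finset.mem_insert.1 (hsub (Finset.mem_insert_self n t)) with h | h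
      · exact h.ge
      · exact (hlt' n h).le
    have htt' : t = t' := h𝓑.incomparable t ht t' ht' fun a ha =>
      (Finset.mem_insert.1 (hsub (Finset.mem_insert_of_mem ha))).resolve_left
        (hmn.trans_lt (hlt a ha)).ne'
    subst htt'
    rcases Finset.mem_insert.1 (hsub (Finset.mem_insert_self n t)) with h | h
    · rw [h]
    · exact absurd (hlt n h) (lt_irrefl n)
  exists_initialSegment := by
    intro A hAS hA
    obtain ⟨s, hs, hsA⟩ := h𝓑.exists_initialSegment A hAS hA
    have hsne := h𝓑.nonempty s hs
    set n := s.min' hsne with hn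
    have hns : n ∈ s := s.min'_mem hsne
    have hmin : ∀ m ∈ s, n ≤ m := fun m hm => s.min'_le m hm
    have hminA : ∀ a ∈ A, n ≤ a := fun a ha => by
      by_contra! h
      exact h.not_ge (hmin a (hsA.2 a ha n hns h.le))
    obtain ⟨t, ht, htA⟩ := h𝓑.exists_initialSegment (A \ {n})
      (Set.sdiff_subset.trans hAS) (hA.sdiff (Set.finite_singleton n))
    have hseg : IsInitialSegment (s.erase n) (A \ {n}) :=
      ⟨fun m hm => ⟨hsA.1 m (Finset.mem_of_mem_erase hm), Finset.ne_of_mem_erase hm⟩,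
        fun a ha m hm ham =>
          Finset.mem_erase.2 ⟨ha.2, hsA.2 a ha.1 m (Finset.mem_of_mem_erase hm) ham⟩⟩
    -- Otherwise `t ⊆ s.erase n`, and incomparability gives `t = s`, although `n ∉ t`.
    have hsub : s.erase n ⊆ t := by
      refine (hseg.subset_or_subset htA).resolve_right fun h => ?_
      have hts : t = s := h𝓑.incomparable t ht s hs (h.trans (Finset.erase_subset n s))
      exact (htA.1 n (hts ▸ hns)).2 rfl
    have hlt : ∀ m ∈ t, n < m := fun m hm =>
      lt_of_le_of_ne (hminA m (htA.1 m hm).1) fun h => (htA.1 m hm).2 h.symm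
    have hst : Precedes s t :=
      ⟨n, hns, hmin, hlt, hsub, fun a ha m hm ham => hseg.2 a (htA.1 a ha) m hm ham⟩
    refine ⟨s ∪ t, ⟨s, hs, t, ht, hst, rfl⟩, fun m hm => ?_, fun a ha m hm ham => ?_⟩
    · exact (Finset.mem_union.1 hm).elim (hsA.1 m) fun h => (htA.1 m h).1
    · rcases Finset.mem_union.1 hm with hm | hm
      · exact Finset.mem_union_left t (hsA.2 a ha m hm ham)
      · by_cases han : a = n
        · exact Finset.mem_union_left t (han ▸ hns)
        · exact Finset.mem_union_right s (htA.2 a ⟨ha, han⟩ m hm ham)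

/-- Deleting the minimum of `s ∪ t` leaves `t`, so `t` and `s'` are both initial segments of `s' ∪
t'`. -/
theorem IsBarrier.eq_of_precedes_union {𝓑 : Set (Finset ℕ)} {S : Set ℕ} (h𝓑 : IsBarrier 𝓑 S)
    {s t s' t' : Finset ℕ} (ht : t ∈ 𝓑) (hs' : s' ∈ 𝓑) (hst : Precedes s t)
    (hst' : Precedes s' t') (h : Precedes (s ∪ t) (s' ∪ t')) : t = s' := by
  obtain ⟨n, hn, hlt⟩ := hst.exists_union_eq_insert
  obtain ⟨m, hm, hmin, -, hseg⟩ := h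
  rw [hn] at hm hmin hseg
  have hmn : m = n := by
    rcases Finset.mem_insert.1 hm with h | h
    · exact h
    · exact absurd (hmin n (Finset.mem_insert_self n t)) (hlt m h).not_ge
  rw [hmn, Finset.erase_insert fun h => lt_irrefl n (hlt n h)] at hseg
  exact h𝓑.eq_of_isInitialSegment ht hs' hseg hst'.isInitialSegment_union

/-! ### Closure properties of better quasi-orders -/

/-- A function of the pairs `s ◁ t` in a barrier, with values in a better quasi-order, takes
comparable values at some consecutive pairs `r ◁ s ◁ t`. -/
theorem BetterQuasiOrdered.exists_le_of_precedes {P : Type*} [LE P] (hP : BetterQuasiOrdered P)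
    {𝓑 : Set (Finset ℕ)} (h𝓑 : IsBarrier 𝓑 Set.univ)
    (g : ∀ s t : 𝓑, Precedes s.1 t.1 → P) :
    ∃ (r s t : 𝓑) (hrs : Precedes r.1 s.1) (hst : Precedes s.1 t.1), g r s hrs ≤ g s t hst := by
  have hu : ∀ u : barrierSquare 𝓑, ∃ s t : 𝓑, Precedes s.1 t.1 ∧ u.1 = s.1 ∪ t.1 := by
    rintro ⟨u, s, hs, t, ht, hst, rfl⟩
    exact ⟨⟨s, hs⟩, ⟨t, ht⟩, hst, rfl⟩
  choose a b hab hu using hu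
  obtain ⟨u, v, huv, hle⟩ := hP _ h𝓑.square fun u => g (a u) (b u) (hab u)
  rw [hu u, hu v] at huv
  have hba : b u = a v :=
    Subtype.ext (h𝓑.eq_of_precedes_union (b u).2 (a v).2 (hab u) (hab v) huv)
  refine ⟨a u, a v, b v, hba ▸ hab u, hab v, ?_⟩
  convert hle using 2
  exact hba.symm

theorem BetterQuasiOrdered.infClosure {L : Type*} [SemilatticeInf L] {Q : Set L}
    (hQ : BetterQuasiOrdered Q) : BetterQuasiOrdered (infClosure Q) := by
  intro 𝓑 h𝓑 f
  by_contra! hbad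
  have hex : ∀ s t : 𝓑, Precedes s.1 t.1 → ∃ q : Q, (f t).1 ≤ q.1 ∧ ¬ (f s).1 ≤ q.1 := by
    intro s t hst
    obtain ⟨F, hF, hFQ, hFt⟩ := (f t).2
    by_contra! h
    refine hbad s t hst ?_
    rw [← Subtype.coe_le_coe, ← hFt]
    refine Finset.le_inf' _ _ fun q hq => h ⟨q, hFQ hq⟩ ?_
    rw [← hFt]
    exact Finset.inf'_le id hq
  choose g hg hg' using hex
  obtain ⟨r, s, t, hrs, hst, hle⟩ := hQ.exists_le_of_precedes h𝓑 g
  exact hg' s t hst ((hg r s hrs).trans hle)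

theorem BetterQuasiOrdered.supClosure {L : Type*} [SemilatticeSup L] {Q : Set L}
    (hQ : BetterQuasiOrdered Q) : BetterQuasiOrdered (supClosure Q) := by
  intro 𝓑 h𝓑 f
  by_contra! hbad
  -- Dually to meets, the witness is a joinand of `f s`, the earlier value.
  have hex : ∀ s t : 𝓑, Precedes s.1 t.1 → ∃ q : Q, q.1 ≤ (f s).1 ∧ ¬ q.1 ≤ (f t).1 := by
    intro s t hst
    obtain ⟨F, hF, hFQ, hFs⟩ := (f s).2
    by_contra! h
    refine hbad s t hst ?_
    rw [← Subtype.coe_le_coe, ← hFs]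
    refine Finset.sup'_le _ _ fun q hq => h ⟨q, hFQ hq⟩ ?_
    rw [← hFs]
    exact Finset.le_sup' id hq
  choose g hg hg' using hex
  obtain ⟨r, s, t, hrs, hst, hle⟩ := hQ.exists_le_of_precedes h𝓑 g
  exact hg' r s hrs ((Subtype.coe_le_coe.2 hle).trans (hg s t hst))

theorem BetterQuasiOrdered.latticeClosure {L : Type*} [DistribLattice L] {Q : Set L}
    (hQ : BetterQuasiOrdered Q) : BetterQuasiOrdered (latticeClosure Q) := by
  rw [← supClosure_infClosure]
  exact hQ.infClosure.supClosure

/-! ### The Rado poset and its poset algebra -/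

theorem RadoPoset.le_def {p q : RadoPoset} :
    p ≤ q ↔ (p.fst = q.fst ∧ p.snd ≤ q.snd) ∨ p.snd < q.fst :=
  Iff.rfl

instance RadoPoset.wellQuasiOrderedLE : WellQuasiOrderedLE RadoPoset where
  wqo f := by
    by_cases h : ∃ n, 0 < n ∧ (f 0).snd < (f n).fst
    · obtain ⟨n, hn, hlt⟩ := h
      exact ⟨0, n, hn, Or.inr hlt⟩
    · push Not at h
      -- All terms after `f 0` have first coordinate at most `(f 0).snd`, so only finitely many
      -- occur; hence the shift to `n + 1` below.
      have hwqo : WellQuasiOrdered fun a b : Fin ((f 0).snd + 1) × ℕ => a.1 = b.1 ∧ a.2 ≤ b.2 :=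
        (Finite.wellQuasiOrdered (α := Fin ((f 0).snd + 1)) (· = ·)).prod wellQuasiOrdered_le
      obtain ⟨m, n, hmn, heq, hle⟩ := hwqo fun n =>
        (⟨(f (n + 1)).fst, Nat.lt_succ_of_le (h (n + 1) n.succ_pos)⟩, (f (n + 1)).snd)
      exact ⟨m + 1, n + 1, Nat.succ_lt_succ hmn, Or.inl ⟨Fin.mk.inj heq, hle⟩⟩

theorem Monotone.wellQuasiOrderedLE_range {α β : Type*} [Preorder α] [Preorder β]
    [WellQuasiOrderedLE α] {f : α → β} (hf : Monotone f) : WellQuasiOrderedLE (Set.range f) where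
  wqo g := by
    choose a ha using fun n => (g n).2
    obtain ⟨m, n, hmn, hle⟩ := wellQuasiOrdered_le a
    refine ⟨m, n, hmn, ?_⟩
    have h : (g m).1 ≤ (g n).1 := by
      rw [← ha m, ← ha n]
      exact hf hle
    exact h

/-- The finite set of all `(k, n)` with `k < n` in the Rado poset. -/
def RadoPoset.column (n : ℕ) : Finset RadoPoset :=
  Finset.univ.map ⟨fun k : Fin n => ⟨k, n, k.2⟩, fun _ _ h =>
    Fin.ext (congrArg RadoPoset.fst h)⟩

theorem RadoPoset.mem_column {n : ℕ} {p : RadoPoset} : p ∈ column n ↔ p.snd = n := by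
  simp only [column, Finset.mem_map, Finset.mem_univ, true_and]
  constructor
  · rintro ⟨k, rfl⟩
    rfl
  · rintro rfl
    exact ⟨⟨p.fst, p.lt⟩, rfl⟩

theorem RadoPoset.column_nonempty {n : ℕ} (hn : 0 < n) : (column n).Nonempty :=
  ⟨⟨0, n, hn⟩, mem_column.2 rfl⟩

/-- A finite meet of generators of a poset algebra lies below a generator `x_q` only if `q` lies
above one of the indices of the meet. -/
theorem PosetAlgebra.exists_le_of_inf'_gen_le {P : Type*} [PartialOrder P] {F : Finset P}
    (hF : F.Nonempty) {q : P} (h : F.inf' hF PosetAlgebra.gen ≤ PosetAlgebra.gen q) :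
    ∃ p ∈ F, p ≤ q := by
  -- The final segment generated by `F` is a point of the meet, hence of `x_q`.
  let U : UpperSet P := ⟨{q | ∃ p ∈ F, p ≤ q}, fun _ _ hab ⟨p, hp, hle⟩ => ⟨p, hp, hle.trans hab⟩⟩
  have hval : ∀ a b : PosetAlgebra P, U ∈ a.1 → U ∈ b.1 → U ∈ (a ⊓ b).1 := fun _ _ ha hb => ⟨ha, hb⟩
  have hU : U ∈ (F.inf' hF PosetAlgebra.gen).1 :=
    Finset.inf'_induction hF PosetAlgebra.gen (p := fun a => U ∈ a.1)
      (fun a ha b hb => hval a b ha hb) fun p hp => ⟨p, hp, le_rfl⟩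
  exact h hU

theorem RadoPoset.not_wellQuasiOrderedLE_latticeClosure :
    ¬ WellQuasiOrderedLE
      (latticeClosure (Set.range (PosetAlgebra.gen : RadoPoset → PosetAlgebra RadoPoset))) := by
  intro hwqo
  have hmem : ∀ n : ℕ, (column (n + 1)).inf' (column_nonempty n.succ_pos) PosetAlgebra.gen ∈
      latticeClosure (Set.range (PosetAlgebra.gen : RadoPoset → PosetAlgebra RadoPoset)) := fun n =>
    isSublattice_latticeClosure.infClosed.finsetInf'_mem _ fun p _ =>
      subset_latticeClosure ⟨p, rfl⟩
  obtain ⟨m, n, hmn, hle⟩ := hwqo.wqo fun n => ⟨_, hmem n⟩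
  -- This `q` is in column `n + 1`, but no `p` in column `m + 1` is below it: that needs `p.fst =
  -- p.snd` or `m + 1 < m + 1`.
  let q : RadoPoset := ⟨m + 1, n + 1, Nat.succ_lt_succ hmn⟩
  obtain ⟨p, hp, hpq⟩ := PosetAlgebra.exists_le_of_inf'_gen_le (column_nonempty m.succ_pos)
    ((Subtype.coe_le_coe.2 hle).trans (Finset.inf'_le PosetAlgebra.gen (mem_column.2 (rfl : q.snd = n + 1))))
  have hsnd := mem_column.1 hp
  have hlt := p.lt
  rcases le_def.1 hpq with ⟨h, -⟩ | h
  · have : p.fst = m + 1 := h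
    omega
  · have : p.snd < m + 1 := h
    omega

theorem proposition2p3 :
    (∀ (B : Type*) [BooleanAlgebra B] (Q : Set B),
      BetterQuasiOrdered Q → BetterQuasiOrdered (latticeClosure Q)) ∧
    (WellQuasiOrderedLE RadoPoset ∧
      WellQuasiOrderedLE
        (Set.range (PosetAlgebra.gen : RadoPoset → PosetAlgebra RadoPoset)) ∧
      ¬ WellQuasiOrderedLE
        (latticeClosure (Set.range (PosetAlgebra.gen : RadoPoset → PosetAlgebra RadoPoset)))) :=

  ⟨fun _ _ _ hQ => hQ.latticeClosure, RadoPoset.wellQuasiOrderedLE,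
    (PosetAlgebra.isPosetAlgebra.{0, 0} RadoPoset).monotone.wellQuasiOrderedLE_range,
    RadoPoset.not_wellQuasiOrderedLE_latticeClosure⟩
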